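/- Let $\Sigma$ be a smooth three-manifold. A Cauchy pair $(\mathfrak{e},\Theta)$ on $\Sigma$ consists of a smooth coframe $\mathfrak{e}=(e_u,e_l,e_n)$ (three one-forms, linearly independent at every point) and a smooth symmetric covariant two-tensor $\Theta$. Let $h = e_u\otimes e_u+e_l\otimes e_l+e_n\otimes e_n$ be the associated Riemannian metric, and for a one-form $\alpha$ write $\Theta(\alpha)=\Theta(\alpha^{\sharp},\cdot)$, where $\alpha^\sharp$ is the $h$-dual vector field. The pair $(\mathfrak{e},\Theta)$ is called parallel if $$\mathrm{d}e_a=\Theta(e_a)\wedge e_u\quad (a=u,l,n),\qquad [\Theta(e_u)]=0\in H^1(\Sigma,\mathbb{R}),$$ the last condition meaning that $\Theta(e_u)$ is exact. Proposition. Let $(\mathfrak{e},\Theta)$ be a parallel Cauchy pair on $\Sigma$. Then the Hamiltonian constraint $$\mathrm{R}_h=|\Theta|_h^2-(\mathrm{Tr}_h\Theta)^2$$ holds on $\Sigma$ if and only if the momentum constraint $$\mathrm{d}\,\mathrm{Tr}_h(\Theta)=\mathrm{div}_h(\Theta)$$ holds on $\Sigma$. Here $\mathrm{R}_h$ is the scalar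 curvature of $h$, and $\mathrm{div}_h(\Theta)(Z)=\sum_a(\nabla^h_{E_a}\Theta)(E_a,Z)$ for an $h$-orthonormal frame $(E_a)$ and the Levi-Civita connection $\nabla^h$. -/

import Mathlib

open scoped Manifold ContDiff Bundle

noncomputable section

namespace ParallelCauchy

/-- Vector fields on a three-manifold, with no regularity imposed. -/
abbrev VField (M : Type*) [TopologicalSpace M] [ChartedSpace (EuclideanSpace ℝ (Fin 3)) M] :
    Type _ :=
  (x : M) → TangentSpace (𝓡 3) x

/-- One-forms on a three-manifold, with no regularity imposed. -/
abbrev OneForm (M : Type*) [TopologicalSpace M] [ChartedSpace (EuclideanSpace ℝ (Fin 3)) M] :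
    Type _ :=
  (x : M) → TangentSpace (𝓡 3) x →L[ℝ] ℝ

/-- Covariant two-tensors on a three-manifold, with no regularity imposed. -/
abbrev TwoTensor (M : Type*) [TopologicalSpace M] [ChartedSpace (EuclideanSpace ℝ (Fin 3)) M] :
    Type _ :=
  (x : M) → TangentSpace (𝓡 3) x →L[ℝ] TangentSpace (𝓡 3) x →L[ℝ] ℝ

section Calculus

variable {M : Type*} [TopologicalSpace M] [ChartedSpace (EuclideanSpace ℝ (Fin 3)) M]

/-- Smoothness of a vector field, as a section of the tangent bundle. -/
def SmoothField [IsManifold (𝓡 3) ∞ M] (X : VField M) : Prop :=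
  ContMDiff (𝓡 3) ((𝓡 3).prod 𝓘(ℝ, EuclideanSpace ℝ (Fin 3))) ∞
    (fun x => Bundle.TotalSpace.mk' (EuclideanSpace ℝ (Fin 3))
      (E := fun y : M => TangentSpace (𝓡 3) y) x (X x))

/-- Smoothness of a one-form, as a section of the cotangent bundle. -/
def SmoothForm [IsManifold (𝓡 3) ∞ M] (α : OneForm M) : Prop :=
  ContMDiff (𝓡 3) ((𝓡 3).prod 𝓘(ℝ, EuclideanSpace ℝ (Fin 3) →L[ℝ] ℝ)) ∞
    (fun x => Bundle.TotalSpace.mk' (EuclideanSpace ℝ (Fin 3) →L[ℝ] ℝ)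
      (E := fun y : M => TangentSpace (𝓡 3) y →L[ℝ] Bundle.Trivial M ℝ y) x (α x))

/-- Smoothness of a covariant two-tensor, as a section of the bundle of bilinear forms. -/
def SmoothTensor [IsManifold (𝓡 3) ∞ M] (T : TwoTensor M) : Prop :=
  ContMDiff (𝓡 3)
    ((𝓡 3).prod 𝓘(ℝ, EuclideanSpace ℝ (Fin 3) →L[ℝ] EuclideanSpace ℝ (Fin 3) →L[ℝ] ℝ)) ∞
    (fun x => Bundle.TotalSpace.mk'
      (EuclideanSpace ℝ (Fin 3) →L[ℝ] EuclideanSpace ℝ (Fin 3) →L[ℝ] ℝ)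
      (E := fun y : M => TangentSpace (𝓡 3) y →L[ℝ] TangentSpace (𝓡 3) y →L[ℝ]
        Bundle.Trivial M ℝ y) x (T x))

/-- The derivative `X(f) = df(X)` of a function `f` along a vector field `X`. -/
def dirDeriv (X : VField M) (f : M → ℝ) (x : M) : ℝ :=
  mvfderiv (𝓡 3) f x (X x)

/-- The exterior derivative of a one-form evaluated on two vector fields:
`dα(X, Y) = X(α(Y)) - Y(α(X)) - α([X, Y])`. -/
def extDerivForm (α : OneForm M) (X Y : VField M) (x : M) : ℝ :=
  dirDeriv X (fun y => α y (Y y)) x - dirDeriv Y (fun y => α y (X y)) x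
    - α x (VectorField.mlieBracket (𝓡 3) X Y x)

/-- The wedge product of two one-forms evaluated on two vector fields:
`(α ∧ β)(X, Y) = α(X) β(Y) - α(Y) β(X)`. -/
def wedge (α β : OneForm M) (X Y : VField M) (x : M) : ℝ :=
  α x (X x) * β x (Y x) - α x (Y x) * β x (X x)

/-- A one-form is exact, that is, closed with vanishing class in `H¹(M, ℝ)`,
if it is the differential of a smooth function. -/
def IsExactForm (α : OneForm M) : Prop :=
  ∃ f : M → ℝ, ContMDiff (𝓡 3) 𝓘(ℝ, ℝ) ∞ f ∧ ∀ x, mvfderiv (𝓡 3) f x = α x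

end Calculus

/-- A smooth coframe `(e_u, e_l, e_n)` on a three-manifold: three smooth one-forms, pointwise
linearly independent. The indices `0, 1, 2` stand for `u, l, n`. -/
structure Coframe (M : Type*) [TopologicalSpace M] [ChartedSpace (EuclideanSpace ℝ (Fin 3)) M]
    [IsManifold (𝓡 3) ∞ M] where
  form : Fin 3 → OneForm M
  smooth : ∀ a, SmoothForm (form a)
  linearIndependent : ∀ x, LinearIndependent ℝ (fun a => form a x)

/-- A shape operator: a smooth symmetric covariant two-tensor. -/
structure ShapeOperator (M : Type*) [TopologicalSpace M]
    [ChartedSpace (EuclideanSpace ℝ (Fin 3)) M] [IsManifold (𝓡 3) ∞ M] where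
  tensor : TwoTensor M
  smooth : SmoothTensor tensor
  symm : ∀ x v w, tensor x v w = tensor x w v

namespace Coframe

variable {M : Type*} [TopologicalSpace M] [ChartedSpace (EuclideanSpace ℝ (Fin 3)) M]
  [IsManifold (𝓡 3) ∞ M] (e : Coframe M)

theorem bijective_pi (x : M) :
    Function.Bijective (LinearMap.pi fun a => (e.form a x : TangentSpace (𝓡 3) x →ₗ[ℝ] ℝ)) := by
  have hdim : Module.finrank ℝ (TangentSpace (𝓡 3) x) = 3 :=
    finrank_euclideanSpace_fin (𝕜 := ℝ) (n := 3)
  have : FiniteDimensional ℝ (TangentSpace (𝓡 3) x) :=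
    inferInstanceAs (FiniteDimensional ℝ (EuclideanSpace ℝ (Fin 3)))
  have hli : LinearIndependent ℝ
      (fun a => (e.form a x : TangentSpace (𝓡 3) x →ₗ[ℝ] ℝ)) :=
    (e.linearIndependent x).map' (ContinuousLinearMap.coeLM ℝ)
      (LinearMap.ker_eq_bot.2 ContinuousLinearMap.coe_injective)
  have hspan : Submodule.span ℝ
      (Set.range fun a => (e.form a x : TangentSpace (𝓡 3) x →ₗ[ℝ] ℝ)) = ⊤ := by
    apply hli.span_eq_top_of_card_eq_finrank'
    rw [Fintype.card_fin]
    exact (Subspace.dual_finrank_eq.trans hdim).symm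
  have hinj : Function.Injective
      (LinearMap.pi fun a => (e.form a x : TangentSpace (𝓡 3) x →ₗ[ℝ] ℝ)) := by
    rw [← LinearMap.ker_eq_bot, LinearMap.ker_eq_bot']
    intro v hv
    rw [← Module.forall_dual_apply_eq_zero_iff ℝ v]
    intro φ
    have hφ : φ ∈ Submodule.span ℝ
        (Set.range fun a => (e.form a x : TangentSpace (𝓡 3) x →ₗ[ℝ] ℝ)) := by
      rw [hspan]; trivial
    induction hφ using Submodule.span_induction with
    | mem ψ hψ =>
      obtain ⟨a, rfl⟩ := hψ
      exact congrFun hv a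
    | zero => rfl
    | add ψ χ _ _ h₁ h₂ => simp [h₁, h₂]
    | smul c ψ _ h₁ => simp [h₁]
  refine ⟨hinj, (LinearMap.injective_iff_surjective_of_finrank_eq_finrank ?_).1 hinj⟩
  rw [hdim, Module.finrank_fin_fun]

/-- The coordinates of tangent vectors at `x` with respect to the coframe. -/
def coordEquiv (x : M) : TangentSpace (𝓡 3) x ≃ₗ[ℝ] (Fin 3 → ℝ) :=
  LinearEquiv.ofBijective _ (e.bijective_pi x)

/-- The frame dual to the coframe: `e_b (frame a) = δ_{ab}`. -/
def frame (a : Fin 3) : VField M :=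
  fun x => (e.coordEquiv x).symm (Pi.single a 1)

theorem form_frame (a b : Fin 3) (x : M) : e.form b x (e.frame a x) = if b = a then 1 else 0 := by
  have h := congrFun ((e.coordEquiv x).apply_symm_apply (Pi.single a 1)) b
  rw [Pi.single_apply] at h
  exact h

/-- The Riemannian metric `h = e_u ⊗ e_u + e_l ⊗ e_l + e_n ⊗ e_n`. The frame dual to the coframe
is orthonormal for it. -/
def metric (X Y : VField M) (x : M) : ℝ :=
  ∑ a, e.form a x (X x) * e.form a x (Y x)

/-- The vector field dual to a one-form with respect to the metric:
`α♯ = ∑ₐ α(Eₐ) Eₐ` for the orthonormal frame `E`. -/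
def sharp (α : OneForm M) : VField M :=
  fun x => ∑ a, α x (e.frame a x) • e.frame a x

/-- The one-form `Θ(α) = Θ(α♯, ·)`. -/
def apply (Θ : ShapeOperator M) (α : OneForm M) : OneForm M :=
  fun x => Θ.tensor x (e.sharp α x)

/-- The right-hand side of the Koszul formula for `h(∇_X Y, Z)`. -/
def koszul (X Y Z : VField M) (x : M) : ℝ :=
  (1 / 2) * (dirDeriv X (e.metric Y Z) x + dirDeriv Y (e.metric X Z) x
    - dirDeriv Z (e.metric X Y) x
    + e.metric (VectorField.mlieBracket (𝓡 3) X Y) Z x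
    - e.metric (VectorField.mlieBracket (𝓡 3) X Z) Y x
    - e.metric (VectorField.mlieBracket (𝓡 3) Y Z) X x)

/-- The Levi-Civita connection `∇_X Y` of the metric `h`, given by the Koszul formula
for `h(∇_X Y, Eₐ)` in the orthonormal frame `E`. -/
def nabla (X Y : VField M) : VField M :=
  fun x => ∑ a, e.koszul X Y (e.frame a) x • e.frame a x

/-- The curvature `R(X, Y)Z = ∇_X ∇_Y Z - ∇_Y ∇_X Z - ∇_[X, Y] Z`. -/
def riemann (X Y Z : VField M) : VField M :=
  e.nabla X (e.nabla Y Z) - e.nabla Y (e.nabla X Z)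
    - e.nabla (VectorField.mlieBracket (𝓡 3) X Y) Z

/-- The Ricci curvature `Ric(Y, Z) = ∑ₐ h(R(Eₐ, Y)Z, Eₐ)`, the trace of `X ↦ R(X, Y)Z`. -/
def ricci (Y Z : VField M) (x : M) : ℝ :=
  ∑ a, e.metric (e.riemann (e.frame a) Y Z) (e.frame a) x

/-- The scalar curvature, the metric trace of the Ricci curvature. -/
def scalarCurvature (x : M) : ℝ :=
  ∑ a, e.ricci (e.frame a) (e.frame a) x

/-- The metric trace of `Θ`. -/
def trace (Θ : ShapeOperator M) (x : M) : ℝ :=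
  ∑ a, Θ.tensor x (e.frame a x) (e.frame a x)

/-- The squared norm of `Θ` as a two-tensor. -/
def normSq (Θ : ShapeOperator M) (x : M) : ℝ :=
  ∑ a, ∑ b, Θ.tensor x (e.frame a x) (e.frame b x) ^ 2

/-- The covariant derivative
`(∇_X Θ)(Y, Z) = X(Θ(Y, Z)) - Θ(∇_X Y, Z) - Θ(Y, ∇_X Z)`. -/
def nablaTensor (Θ : ShapeOperator M) (X Y Z : VField M) (x : M) : ℝ :=
  dirDeriv X (fun y => Θ.tensor y (Y y) (Z y)) x
    - Θ.tensor x (e.nabla X Y x) (Z x) - Θ.tensor x (Y x) (e.nabla X Z x)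

/-- The divergence `div(Θ)(Z) = ∑ₐ (∇_{Eₐ} Θ)(Eₐ, Z)`. -/
def div (Θ : ShapeOperator M) (Z : VField M) (x : M) : ℝ :=
  ∑ a, e.nablaTensor Θ (e.frame a) (e.frame a) Z x

end Coframe

section Pairs

variable {M : Type*} [TopologicalSpace M] [ChartedSpace (EuclideanSpace ℝ (Fin 3)) M]
  [IsManifold (𝓡 3) ∞ M]

/-- A Cauchy pair `(e, Θ)` is parallel if `d e_a = Θ(e_a) ∧ e_u` for `a = u, l, n`, and
`[Θ(e_u)] = 0` in `H¹(M, ℝ)`. -/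
structure IsParallelCauchyPair (e : Coframe M) (Θ : ShapeOperator M) : Prop where
  extDeriv_eq : ∀ (a : Fin 3) (X Y : VField M), SmoothField X → SmoothField Y → ∀ x,
    extDerivForm (e.form a) X Y x = wedge (e.apply Θ (e.form a)) (e.form 0) X Y x
  exact_apply : IsExactForm (e.apply Θ (e.form 0))

/-- The Hamiltonian constraint `R_h = |Θ|² - (Tr Θ)²`. -/
def HamiltonianConstraint (e : Coframe M) (Θ : ShapeOperator M) : Prop :=
  ∀ x, e.scalarCurvature x = e.normSq Θ x - e.trace Θ x ^ 2

/-- The momentum constraint `d Tr Θ = div Θ`, an equality of one-forms. -/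
def MomentumConstraint (e : Coframe M) (Θ : ShapeOperator M) : Prop :=
  ∀ Z : VField M, SmoothField Z → ∀ x, dirDeriv Z (e.trace Θ) x = e.div Θ Z x

end Pairs

end ParallelCauchy

end

/-! In the dual frame $E_0, E_1, E_2$ the condition $\mathrm{d}e_a = \Theta(e_a)\wedge e_u$ fixes
all Lie brackets, hence the Levi-Civita connection: $(\nabla_{E_a}E_b)^c = \Theta_{ab}\delta_{0c} -
\Theta_{ca}\delta_{0b}$ (`koszul_frame`). Curvature and divergence become first-order expressions in
the $\Theta_{ab}$. The planes containing $E_0$ contribute $E_0\Theta_{bb} - E_b\Theta_{0b}$ plus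
quadratic terms, and the plane of $E_1, E_2$ only quadratic ones. Summing, the Hamiltonian defect is
exactly twice the $E_0$-component of the momentum defect (`scalarCurvature_sub`).

The other two components of the momentum constraint hold for every parallel pair (`momentum_frame`).
Their derivative terms split into a part governed by closedness of $\Theta(e_u)$ and a part governed
by $\mathrm{d}^2e_c = 0$, used here as the Jacobi identity. As the divergence is tensorial
(`div_eq_sum`), testing on the frame suffices, and both constraints reduce to the same scalar
equation. -/

noncomputable section

namespace ParallelCauchy

/-! ### Smooth sections, and smoothness of the dual frame. -/

section Smoothness

variable {M : Type*} [TopologicalSpace M] [ChartedSpace (EuclideanSpace ℝ (Fin 3)) M]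
  [IsManifold (𝓡 3) ∞ M]

/-- Smoothness of a vector field at a point. -/
def SmoothFieldAt (X : VField M) (x : M) : Prop :=
  ContMDiffAt (𝓡 3) ((𝓡 3).prod 𝓘(ℝ, EuclideanSpace ℝ (Fin 3))) ∞
    (fun x => Bundle.TotalSpace.mk' (EuclideanSpace ℝ (Fin 3))
      (E := fun y : M => TangentSpace (𝓡 3) y) x (X x)) x

/-- A smooth real function on a three-manifold. -/
abbrev SmoothFunction (f : M → ℝ) : Prop := ContMDiff (𝓡 3) 𝓘(ℝ, ℝ) ∞ f

theorem SmoothForm.contMDiffAt_apply {α : OneForm M} (hα : SmoothForm α) {X : VField M} {x : M}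
    (hX : SmoothFieldAt X x) : ContMDiffAt (𝓡 3) 𝓘(ℝ, ℝ) ∞ (fun y => α y (X y)) x := by
  have h := ContMDiffAt.clm_bundle_apply (hα x) hX
  rw [Bundle.contMDiffAt_section] at h
  exact h

theorem SmoothForm.smoothFunction_apply {α : OneForm M} (hα : SmoothForm α) {X : VField M}
    (hX : SmoothField X) : SmoothFunction (fun y => α y (X y)) :=
  fun x => hα.contMDiffAt_apply (hX x)

theorem SmoothTensor.smoothFunction_apply {T : TwoTensor M} (hT : SmoothTensor T) {X Y : VField M}
    (hX : SmoothField X) (hY : SmoothField Y) : SmoothFunction (fun y => T y (X y) (Y y)) := by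
  intro x
  have h := ContMDiffAt.clm_bundle_apply₂ (hT x) (hX x) (hY x)
  rw [Bundle.contMDiffAt_section] at h
  exact h

omit [IsManifold (𝓡 3) ∞ M] in
theorem SmoothFunction.mdifferentiableAt {f : M → ℝ} (hf : SmoothFunction f) (x : M) :
    MDifferentiableAt (𝓡 3) 𝓘(ℝ, ℝ) f x :=
  (hf x).mdifferentiableAt (by simp)

theorem SmoothField.mdifferentiableAt {X : VField M} (hX : SmoothField X) (x : M) :
    MDifferentiableAt (𝓡 3) ((𝓡 3).prod 𝓘(ℝ, EuclideanSpace ℝ (Fin 3)))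
      (fun x => (X x : TangentBundle (𝓡 3) M)) x :=
  (hX x).mdifferentiableAt (by simp)

theorem SmoothField.smul {f : M → ℝ} {X : VField M} (hf : SmoothFunction f) (hX : SmoothField X) :
    SmoothField (f • X) :=
  fun x => (hf x).smul_section (hX x)

instance isManifold_minSmoothness_two : IsManifold (𝓡 3) (minSmoothness ℝ 2) M :=
  IsManifold.of_le (n := ∞) (by simpa using ENat.LEInfty.out)

instance isManifold_minSmoothness_three : IsManifold (𝓡 3) (minSmoothness ℝ 3) M :=
  IsManifold.of_le (n := ∞) (by simpa using ENat.LEInfty.out)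

theorem SmoothField.lieBracket {X Y : VField M} (hX : SmoothField X) (hY : SmoothField Y) :
    SmoothField (VectorField.mlieBracket (𝓡 3) X Y) := by
  intro x
  -- The bracket costs one derivative, which is harmless since $\infty + 1 = \infty$.
  have : IsManifold (𝓡 3) ((⊤ : ℕ∞) + 1) M := inferInstanceAs (IsManifold (𝓡 3) ∞ M)
  exact ContMDiffAt.mlieBracket_vectorField (m := ⊤) (n := ⊤) (hX x) (hY x) (by simp)

omit [IsManifold (𝓡 3) ∞ M] in
theorem contMDiffAt_matrix_det {A : M → Matrix (Fin 3) (Fin 3) ℝ} {x : M}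
    (hA : ∀ i j, ContMDiffAt (𝓡 3) 𝓘(ℝ, ℝ) ∞ (fun y => A y i j) x) :
    ContMDiffAt (𝓡 3) 𝓘(ℝ, ℝ) ∞ (fun y => (A y).det) x := by
  simp only [Matrix.det_apply']
  exact contMDiffAt_finsetSum fun σ _ =>
    contMDiffAt_const.mul (contMDiffAt_finsetProd fun i _ => hA (σ i) i)

-- Cramer's rule: each entry is a determinant, with one row replaced by a constant vector, divided
-- by $\det A$.
omit [IsManifold (𝓡 3) ∞ M] in
theorem contMDiffAt_matrix_inv {A : M → Matrix (Fin 3) (Fin 3) ℝ} {x : M}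
    (hA : ∀ i j, ContMDiffAt (𝓡 3) 𝓘(ℝ, ℝ) ∞ (fun y => A y i j) x) (hx : (A x).det ≠ 0)
    (i j : Fin 3) : ContMDiffAt (𝓡 3) 𝓘(ℝ, ℝ) ∞ (fun y => (A y)⁻¹ i j) x := by
  simp only [Matrix.inv_def, Ring.inverse_eq_inv', Matrix.smul_apply, smul_eq_mul,
    Matrix.adjugate_apply]
  refine ((contMDiffAt_matrix_det hA).inv₀ hx).mul (contMDiffAt_matrix_det fun k l => ?_)
  by_cases h : k = j
  · subst h
    simpa using contMDiffAt_const
  · simpa [Matrix.updateRow_ne h] using hA k l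

namespace Coframe

variable (e : Coframe M)

theorem sum_form_smul_frame (x : M) (v : TangentSpace (𝓡 3) x) :
    ∑ a, e.form a x v • e.frame a x = v := by
  apply (e.bijective_pi x).1
  ext b
  simp [form_frame]

theorem ext_form {x : M} {v w : TangentSpace (𝓡 3) x} (h : ∀ a, e.form a x v = e.form a x w) :
    v = w := by
  rw [← e.sum_form_smul_frame x v, ← e.sum_form_smul_frame x w]
  simp [h]

theorem det_form_basis_ne_zero (x : M) (b : Module.Basis (Fin 3) ℝ (TangentSpace (𝓡 3) x)) :
    (Matrix.of fun c i => e.form c x (b i)).det ≠ 0 := by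
  have h : (Matrix.of fun c i => e.form c x (b i)) =
      LinearMap.toMatrix' (b.equivFun.symm.trans (e.coordEquiv x)).toLinearMap := by
    ext c i
    rw [LinearMap.toMatrix'_apply, LinearEquiv.coe_coe, LinearEquiv.trans_apply,
      Module.Basis.equivFun_symm_apply]
    simp only [Pi.single_apply, ite_smul, one_smul, zero_smul, Finset.sum_ite_eq',
      Finset.mem_univ, if_true, Matrix.of_apply]
    rfl
  rw [h, LinearMap.det_toMatrix']
  exact (b.equivFun.symm.trans (e.coordEquiv x)).isUnit_det'.ne_zero

/-- The dual frame is defined pointwise; inverting the matrix of the coframe in a known basis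
expresses it through coefficients whose smoothness can be checked. -/
theorem frame_eq_sum_inv (a : Fin 3) (x : M)
    (b : Module.Basis (Fin 3) ℝ (TangentSpace (𝓡 3) x)) :
    e.frame a x = ∑ i, (Matrix.of fun c i => e.form c x (b i))⁻¹ i a • b i := by
  apply e.ext_form
  intro c
  have h := congrFun (congrFun (Matrix.mul_nonsing_inv _
    (e.det_form_basis_ne_zero x b).isUnit) c) a
  rw [Matrix.mul_apply, Matrix.one_apply] at h
  rw [e.form_frame, ← h, map_sum]
  refine Finset.sum_congr rfl fun i _ => ?_
  rw [map_smul, smul_eq_mul, mul_comm, Matrix.of_apply]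

theorem smoothFieldAt_frame (a : Fin 3) {x : M} {U : Set M} (hU : U ∈ nhds x)
    {s : Fin 3 → VField M} (hs : ∀ i, SmoothFieldAt (s i) x)
    (hb : ∀ y ∈ U, ∃ b : Module.Basis (Fin 3) ℝ (TangentSpace (𝓡 3) y), ∀ i, b i = s i y) :
    SmoothFieldAt (e.frame a) x := by
  have hdet : (Matrix.of fun c i => e.form c x (s i x)).det ≠ 0 := by
    obtain ⟨b, hb⟩ := hb x (mem_of_mem_nhds hU)
    simpa only [hb] using e.det_form_basis_ne_zero x b
  have hinv : ∀ i, ContMDiffAt (𝓡 3) 𝓘(ℝ, ℝ) ∞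
      (fun y => (Matrix.of fun c i => e.form c y (s i y))⁻¹ i a) x :=
    fun i => contMDiffAt_matrix_inv (fun c j => (e.smooth c).contMDiffAt_apply (hs j)) hdet i a
  have hsum : SmoothFieldAt
      (fun y => ∑ i, (Matrix.of fun c i => e.form c y (s i y))⁻¹ i a • s i y) x :=
    ContMDiffAt.sum_section fun i _ => (hinv i).smul_section (hs i)
  refine hsum.congr_of_eventuallyEq ?_
  filter_upwards [hU] with y hy
  obtain ⟨b, hb⟩ := hb y hy
  rw [e.frame_eq_sum_inv a y b]
  simp only [hb]

/-- The dual frame of a smooth coframe is smooth. -/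
theorem smooth_frame (a : Fin 3) : SmoothField (e.frame a) := by
  intro x
  have hx : x ∈ (trivializationAt (EuclideanSpace ℝ (Fin 3))
      (TangentSpace (𝓡 3) : M → Type _) x).baseSet :=
    FiberBundle.mem_baseSet_trivializationAt' x
  revert hx
  generalize ht : trivializationAt (EuclideanSpace ℝ (Fin 3)) (TangentSpace (𝓡 3) : M → Type _) x
    = t
  intro hx
  have : MemTrivializationAtlas t := ht ▸ inferInstance
  refine e.smoothFieldAt_frame a (t.open_baseSet.mem_nhds hx)
    (fun i => contMDiffAt_localFrame_of_mem _ t (EuclideanSpace.basisFun (Fin 3) ℝ).toBasis i hx)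
    fun y hy => ⟨t.basisAt (EuclideanSpace.basisFun (Fin 3) ℝ).toBasis hy, fun i => ?_⟩
  rw [Bundle.Trivialization.localFrame_apply_of_mem_baseSet _ _ hy]

end Coframe

end Smoothness

/-! ### Directional derivatives and Lie brackets. -/

section Calculus

variable {M : Type*} [TopologicalSpace M] [ChartedSpace (EuclideanSpace ℝ (Fin 3)) M]
  [IsManifold (𝓡 3) ∞ M]

omit [IsManifold (𝓡 3) ∞ M] in
theorem dirDeriv_const (X : VField M) (c : ℝ) (x : M) : dirDeriv X (fun _ => c) x = 0 := by
  rw [dirDeriv, mvfderiv_const]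
  rfl

omit [IsManifold (𝓡 3) ∞ M] in
theorem dirDeriv_add {X : VField M} {f g : M → ℝ} (hf : SmoothFunction f) (hg : SmoothFunction g)
    (x : M) : dirDeriv X (fun y => f y + g y) x = dirDeriv X f x + dirDeriv X g x := by
  simp [dirDeriv, mvfderiv_fun_add (hf.mdifferentiableAt x) (hg.mdifferentiableAt x)]

omit [IsManifold (𝓡 3) ∞ M] in
theorem dirDeriv_neg {X : VField M} {f : M → ℝ} (x : M) :
    dirDeriv X (fun y => -f y) x = -dirDeriv X f x := by
  rw [dirDeriv, mvfderiv_fun_neg]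
  rfl

omit [IsManifold (𝓡 3) ∞ M] in
theorem dirDeriv_mul {X : VField M} {f g : M → ℝ} (hf : SmoothFunction f) (hg : SmoothFunction g)
    (x : M) :
    dirDeriv X (fun y => f y * g y) x = f x * dirDeriv X g x + g x * dirDeriv X f x := by
  simp [dirDeriv, mvfderiv_fun_mul (hf.mdifferentiableAt x) (hg.mdifferentiableAt x)]

omit [IsManifold (𝓡 3) ∞ M] in
theorem dirDeriv_sum {X : VField M} {f : Fin 3 → M → ℝ} (hf : ∀ a, SmoothFunction (f a)) (x : M) :
    dirDeriv X (fun y => ∑ a, f a y) x = ∑ a, dirDeriv X (f a) x := by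
  simp only [Fin.sum_univ_three]
  rw [dirDeriv_add (f := fun y => f 0 y + f 1 y) ((hf 0).add (hf 1)) (hf 2), dirDeriv_add (hf 0) (hf 1)]

theorem Coframe.dirDeriv_eq_sum (e : Coframe M) (X : VField M) (f : M → ℝ) (x : M) :
    dirDeriv X f x = ∑ a, e.form a x (X x) * dirDeriv (e.frame a) f x := by
  unfold dirDeriv
  conv_lhs => rw [← e.sum_form_smul_frame x (X x)]
  simp

theorem lieBracket_smul {X Y : VField M} (hY : SmoothField Y) {f : M → ℝ}
    (hf : SmoothFunction f) : VectorField.mlieBracket (𝓡 3) X (f • Y) =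
      dirDeriv X f • Y + f • VectorField.mlieBracket (𝓡 3) X Y := by
  ext1 y
  exact VectorField.mlieBracket_smul_right (hf.mdifferentiableAt y) (hY.mdifferentiableAt y)

/-- Since $[X, fE_0] = X(f)E_0 + f[X, E_0]$, the function $X(f)$ can be read off from brackets,
which are already known to be smooth. -/
theorem Coframe.smoothFunction_dirDeriv (e : Coframe M) {X : VField M} (hX : SmoothField X)
    {f : M → ℝ} (hf : SmoothFunction f) : SmoothFunction (dirDeriv X f) := by
  have h : dirDeriv X f = fun y =>
      e.form 0 y (VectorField.mlieBracket (𝓡 3) X (f • e.frame 0) y) -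
        f y * e.form 0 y (VectorField.mlieBracket (𝓡 3) X (e.frame 0) y) := by
    ext y
    rw [lieBracket_smul (e.smooth_frame 0) hf]
    simp [form_frame]
  rw [h]
  exact ((e.smooth 0).smoothFunction_apply (hX.lieBracket ((e.smooth_frame 0).smul hf))).sub
    (hf.mul ((e.smooth 0).smoothFunction_apply (hX.lieBracket (e.smooth_frame 0))))

theorem leibniz_identity_lieBracket {X Y Z : VField M} (hX : SmoothField X) (hY : SmoothField Y)
    (hZ : SmoothField Z) (x : M) :
    VectorField.mlieBracket (𝓡 3) X (VectorField.mlieBracket (𝓡 3) Y Z) x =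
      VectorField.mlieBracket (𝓡 3) (VectorField.mlieBracket (𝓡 3) X Y) Z x +
        VectorField.mlieBracket (𝓡 3) Y (VectorField.mlieBracket (𝓡 3) X Z) x := by
  have h2 : ∀ {W : VField M}, SmoothField W → ContMDiffAt (𝓡 3)
      ((𝓡 3).prod 𝓘(ℝ, EuclideanSpace ℝ (Fin 3))) (minSmoothness ℝ 2)
      (fun x => (W x : TangentBundle (𝓡 3) M)) x :=
    fun hW => (hW x).of_le (by simpa using ENat.LEInfty.out)
  exact VectorField.leibniz_identity_mlieBracket_apply (h2 hX) (h2 hY) (h2 hZ)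

/-- The commutator of directional derivatives is the derivative along the Lie bracket. -/
theorem Coframe.dirDeriv_lieBracket (e : Coframe M) {X Y : VField M} (hX : SmoothField X)
    (hY : SmoothField Y) {f : M → ℝ} (hf : SmoothFunction f) (x : M) :
    dirDeriv (VectorField.mlieBracket (𝓡 3) X Y) f x =
      dirDeriv X (dirDeriv Y f) x - dirDeriv Y (dirDeriv X f) x := by
  have hZ := e.smooth_frame 0
  have hXf := e.smoothFunction_dirDeriv hX hf
  have hYf := e.smoothFunction_dirDeriv hY hf
  have hadd : ∀ {W V V' : VField M}, SmoothField V → SmoothField V' →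
      VectorField.mlieBracket (𝓡 3) W (V + V') x =
        VectorField.mlieBracket (𝓡 3) W V x + VectorField.mlieBracket (𝓡 3) W V' x :=
    fun hV hV' => VectorField.mlieBracket_add_right (hV.mdifferentiableAt x)
      (hV'.mdifferentiableAt x)
  -- Jacobi for $X, Y, fE_0$, expanded by the Leibniz rule: subtracting $f$ times Jacobi for $X, Y,
  -- E_0$ leaves the commutator identity as the coefficient of $E_0$.
  have h := leibniz_identity_lieBracket hX hY (hZ.smul hf) x
  have hL := leibniz_identity_lieBracket hX hY hZ x
  have hXZ := hX.lieBracket hZ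
  have hYZ := hY.lieBracket hZ
  rw [lieBracket_smul hZ hf, lieBracket_smul hZ hf, lieBracket_smul hZ hf,
    hadd (hZ.smul hYf) (hYZ.smul hf),
    hadd (hZ.smul hXf) (hXZ.smul hf), lieBracket_smul hZ hYf, lieBracket_smul hYZ hf,
    lieBracket_smul hZ hXf, lieBracket_smul hXZ hf] at h
  simp only [Pi.add_apply, Pi.smul_apply'] at h
  rw [hL] at h
  have h' := congrArg (e.form 0 x) h
  simp only [map_add, map_smul, smul_eq_mul, e.form_frame, if_true] at h'
  linarith

end Calculus

/-! ### Components in the frame and the Levi-Civita connection of a parallel pair. -/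

section Connection

variable {M : Type*} [TopologicalSpace M] [ChartedSpace (EuclideanSpace ℝ (Fin 3)) M]
  [IsManifold (𝓡 3) ∞ M] (e : Coframe M) (Θ : ShapeOperator M)

namespace Coframe

/-- The components `Θ_{ab}` of a shape operator in the frame dual to a coframe. -/
def comp (a b : Fin 3) (x : M) : ℝ := Θ.tensor x (e.frame a x) (e.frame b x)

theorem comp_comm (a b : Fin 3) : e.comp Θ a b = e.comp Θ b a :=
  funext fun x => Θ.symm x _ _

theorem smoothFunction_comp (a b : Fin 3) : SmoothFunction (e.comp Θ a b) :=
  Θ.smooth.smoothFunction_apply (e.smooth_frame a) (e.smooth_frame b)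

theorem tensor_frame_apply (a : Fin 3) (x : M) (v : TangentSpace (𝓡 3) x) :
    Θ.tensor x (e.frame a x) v = ∑ b, e.form b x v * e.comp Θ a b x := by
  conv_lhs => rw [← e.sum_form_smul_frame x v]
  simp [comp]

theorem tensor_apply (x : M) (v w : TangentSpace (𝓡 3) x) :
    Θ.tensor x v w = ∑ a, ∑ b, e.form a x v * e.form b x w * e.comp Θ a b x := by
  conv_lhs => rw [← e.sum_form_smul_frame x v]
  simp [tensor_frame_apply, Finset.mul_sum, mul_assoc]

theorem apply_form (a : Fin 3) (x : M) (v : TangentSpace (𝓡 3) x) :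
    e.apply Θ (e.form a) x v = Θ.tensor x (e.frame a x) v := by
  simp [apply, sharp, form_frame]

theorem metric_frame_right (X : VField M) (a : Fin 3) :
    e.metric X (e.frame a) = fun x => e.form a x (X x) := by
  ext x
  simp [metric, form_frame]

theorem form_nabla (X Y : VField M) (c : Fin 3) (x : M) :
    e.form c x (e.nabla X Y x) = e.koszul X Y (e.frame c) x := by
  simp [nabla, form_frame]

theorem smoothFunction_form {X : VField M} (hX : SmoothField X) (a : Fin 3) :
    SmoothFunction (fun x => e.form a x (X x)) :=
  (e.smooth a).smoothFunction_apply hX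

theorem smoothFunction_metric {X Y : VField M} (hX : SmoothField X) (hY : SmoothField Y) :
    SmoothFunction (e.metric X Y) := fun _ => contMDiffAt_finsetSum fun a _ =>
  (e.smoothFunction_form hX a _).mul (e.smoothFunction_form hY a _)

theorem dirDeriv_metric (Z : VField M) {X Y : VField M} (hX : SmoothField X) (hY : SmoothField Y)
    (x : M) :
    dirDeriv Z (e.metric X Y) x = ∑ a, (e.form a x (X x) * dirDeriv Z (fun y => e.form a y (Y y)) x
      + e.form a x (Y x) * dirDeriv Z (fun y => e.form a y (X y)) x) := by
  rw [show e.metric X Y = fun x => ∑ a, e.form a x (X x) * e.form a x (Y x) from rfl,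
    dirDeriv_sum (f := fun a x => e.form a x (X x) * e.form a x (Y x))
      fun a => (e.smoothFunction_form hX a).mul (e.smoothFunction_form hY a)]
  exact Finset.sum_congr rfl fun a _ =>
    dirDeriv_mul (e.smoothFunction_form hX a) (e.smoothFunction_form hY a) x

theorem dirDeriv_form_frame (X : VField M) (a b : Fin 3) (x : M) :
    dirDeriv X (fun y => e.form a y (e.frame b y)) x = 0 := by
  simp only [form_frame]
  exact dirDeriv_const X _ x

theorem smoothField_nabla {X Y : VField M} (hX : SmoothField X) (hY : SmoothField Y) :
    SmoothField (e.nabla X Y) := by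
  have hk : ∀ a, SmoothFunction (e.koszul X Y (e.frame a)) := fun a => by
    have hE := e.smooth_frame a
    exact contMDiff_const.mul ((((((e.smoothFunction_dirDeriv hX (e.smoothFunction_metric hY hE)).add
      (e.smoothFunction_dirDeriv hY (e.smoothFunction_metric hX hE))).sub
      (e.smoothFunction_dirDeriv hE (e.smoothFunction_metric hX hY))).add
      (e.smoothFunction_metric (hX.lieBracket hY) hE)).sub
      (e.smoothFunction_metric (hX.lieBracket hE) hY)).sub
      (e.smoothFunction_metric (hY.lieBracket hE) hX))
  exact fun x => ContMDiffAt.sum_section fun a _ => (hk a x).smul_section (e.smooth_frame a x)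

end Coframe

namespace IsParallelCauchyPair

variable {e Θ} (h : IsParallelCauchyPair e Θ)

include h

/-- The first structure equation of a parallel Cauchy pair, solved for the Lie bracket. -/
theorem form_lieBracket {X Y : VField M} (hX : SmoothField X) (hY : SmoothField Y) (c : Fin 3)
    (x : M) :
    e.form c x (VectorField.mlieBracket (𝓡 3) X Y x) =
      dirDeriv X (fun y => e.form c y (Y y)) x - dirDeriv Y (fun y => e.form c y (X y)) x
      - Θ.tensor x (e.frame c x) (X x) * e.form 0 x (Y x)
      + Θ.tensor x (e.frame c x) (Y x) * e.form 0 x (X x) := by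
  have h1 := h.extDeriv_eq c X Y hX hY x
  simp only [extDerivForm, wedge, e.apply_form] at h1
  linarith

/-- The Levi-Civita connection of a parallel Cauchy pair:
`(∇_X Y)^c = X(Y^c) + Θ(X, Y) δ_{c u} - Θ(X, E_c) Y^u`. -/
theorem koszul_frame {X Y : VField M} (hX : SmoothField X) (hY : SmoothField Y) (c : Fin 3)
    (x : M) :
    e.koszul X Y (e.frame c) x = dirDeriv X (fun y => e.form c y (Y y)) x
      + Θ.tensor x (X x) (Y x) * (if 0 = c then 1 else 0)
      - Θ.tensor x (e.frame c x) (X x) * e.form 0 x (Y x) := by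
  have hE := e.smooth_frame c
  simp only [Coframe.koszul, e.metric_frame_right, e.dirDeriv_metric _ hX hY]
  simp only [Coframe.metric, h.form_lieBracket hX hY, h.form_lieBracket hX hE,
    h.form_lieBracket hY hE, dirDeriv_const, e.form_frame]
  rw [e.tensor_apply Θ x (X x) (Y x)]
  simp only [e.tensor_frame_apply Θ, e.form_frame, Fin.sum_univ_three, e.comp_comm Θ 1 0,
    e.comp_comm Θ 2 0, e.comp_comm Θ 2 1]
  fin_cases c <;> simp [e.comp_comm Θ 1 0, e.comp_comm Θ 2 0, e.comp_comm Θ 2 1] <;> ring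

end IsParallelCauchyPair

end Connection

/-! ### Curvature, divergence and the two constraints. -/

section Constraints

variable {M : Type*} [TopologicalSpace M] [ChartedSpace (EuclideanSpace ℝ (Fin 3)) M]
  [IsManifold (𝓡 3) ∞ M] {e : Coframe M} {Θ : ShapeOperator M}

theorem dirDeriv_comp_mul_sub (e : Coframe M) (Θ : ShapeOperator M) (X : VField M)
    (a b c d : Fin 3) (r s : ℝ) (x : M) :
    dirDeriv X (fun y => e.comp Θ a b y * r - e.comp Θ c d y * s) x =
      r * dirDeriv X (e.comp Θ a b) x - s * dirDeriv X (e.comp Θ c d) x := by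
  simp only [sub_eq_add_neg]
  rw [dirDeriv_add (f := fun y => e.comp Θ a b y * r) (g := fun y => -(e.comp Θ c d y * s))
      ((e.smoothFunction_comp Θ a b).mul contMDiff_const)
      ((e.smoothFunction_comp Θ c d).mul contMDiff_const).neg, dirDeriv_neg,
    dirDeriv_mul (e.smoothFunction_comp Θ a b) contMDiff_const,
    dirDeriv_mul (e.smoothFunction_comp Θ c d) contMDiff_const]
  simp [dirDeriv_const]

theorem dirDeriv_trace (e : Coframe M) (Θ : ShapeOperator M)
    (X : VField M) (x : M) :
    dirDeriv X (e.trace Θ) x = ∑ a, dirDeriv X (e.comp Θ a a) x :=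
  dirDeriv_sum (f := fun a => e.comp Θ a a) (fun a => e.smoothFunction_comp Θ a a) x

namespace IsParallelCauchyPair

variable (h : IsParallelCauchyPair e Θ)

include h

theorem form_nabla {X Y : VField M} (hX : SmoothField X) (hY : SmoothField Y) (c : Fin 3)
    (x : M) :
    e.form c x (e.nabla X Y x) = dirDeriv X (fun y => e.form c y (Y y)) x
      + Θ.tensor x (X x) (Y x) * (if 0 = c then 1 else 0)
      - Θ.tensor x (e.frame c x) (X x) * e.form 0 x (Y x) := by
  rw [e.form_nabla, h.koszul_frame hX hY]

theorem form_nabla_frame (a b c : Fin 3) (x : M) :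
    e.form c x (e.nabla (e.frame a) (e.frame b) x) =
      e.comp Θ a b x * (if 0 = c then 1 else 0) - e.comp Θ c a x * (if 0 = b then 1 else 0) := by
  rw [h.form_nabla (e.smooth_frame a) (e.smooth_frame b), e.dirDeriv_form_frame, zero_add,
    e.form_frame]
  rfl

theorem form_lieBracket_frame (a b c : Fin 3) (x : M) :
    e.form c x (VectorField.mlieBracket (𝓡 3) (e.frame a) (e.frame b) x) =
      e.comp Θ c b x * (if 0 = a then 1 else 0) - e.comp Θ c a x * (if 0 = b then 1 else 0) := by
  rw [h.form_lieBracket (e.smooth_frame a) (e.smooth_frame b), e.dirDeriv_form_frame,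
    e.dirDeriv_form_frame, e.form_frame, e.form_frame]
  simp only [Coframe.comp]
  ring

/-- The components `h(R(E_a, E_b)E_b, E_a)` of the curvature of a parallel Cauchy pair. -/
theorem form_riemann_frame (a b : Fin 3) (x : M) :
    e.form a x (e.riemann (e.frame a) (e.frame b) (e.frame b) x) =
      (if 0 = a then 1 else 0) * dirDeriv (e.frame a) (e.comp Θ b b) x
      - (if 0 = b then 1 else 0) * dirDeriv (e.frame a) (e.comp Θ a b) x
      - (if 0 = a then 1 else 0) * dirDeriv (e.frame b) (e.comp Θ a b) x
      + (if 0 = b then 1 else 0) * dirDeriv (e.frame b) (e.comp Θ a a) x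
      - (if 0 = a then 1 else 0) * ∑ c, e.comp Θ b c x ^ 2
      - (if 0 = b then 1 else 0) * ∑ c, e.comp Θ a c x ^ 2
      + 2 * (if 0 = a then 1 else 0) * (if 0 = b then 1 else 0)
        * ∑ c, e.comp Θ a c x * e.comp Θ b c x
      + (if 0 = b then 1 else 0) * (e.comp Θ a a x * e.comp Θ 0 b x)
      + (if 0 = a then 1 else 0) * (e.comp Θ b b x * e.comp Θ a 0 x)
      - (if 0 = a then 1 else 0) * (e.comp Θ a b x * e.comp Θ 0 b x)
      - (if 0 = b then 1 else 0) * (e.comp Θ a b x * e.comp Θ a 0 x)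
      - (e.comp Θ a a x * e.comp Θ b b x - e.comp Θ a b x ^ 2) := by
  have hE := e.smooth_frame
  simp only [Coframe.riemann, Pi.sub_apply, map_sub]
  rw [h.form_nabla (hE a) (e.smoothField_nabla (hE b) (hE b)),
    h.form_nabla (hE b) (e.smoothField_nabla (hE a) (hE b)),
    h.form_nabla ((hE a).lieBracket (hE b)) (hE b), e.dirDeriv_form_frame]
  simp only [h.form_nabla_frame, dirDeriv_comp_mul_sub]
  -- Puts the frame vector in the first slot, where `tensor_frame_apply` can expand.
  rw [Θ.symm x (VectorField.mlieBracket (𝓡 3) (e.frame a) (e.frame b) x)]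
  simp only [e.tensor_frame_apply Θ, h.form_nabla_frame, h.form_lieBracket_frame, e.form_frame,
    Fin.sum_univ_three]
  fin_cases a <;> fin_cases b <;>
    simp [e.comp_comm Θ 1 0, e.comp_comm Θ 2 0, e.comp_comm Θ 2 1] <;> ring

theorem div_frame (c : Fin 3) (x : M) :
    e.div Θ (e.frame c) x = ∑ a, (dirDeriv (e.frame a) (e.comp Θ a c) x
      - ∑ d, (e.comp Θ a a x * (if 0 = d then 1 else 0)
          - e.comp Θ d a x * (if 0 = a then 1 else 0)) * e.comp Θ c d x
      - ∑ d, (e.comp Θ a c x * (if 0 = d then 1 else 0)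
          - e.comp Θ d a x * (if 0 = c then 1 else 0)) * e.comp Θ a d x) := by
  refine Finset.sum_congr rfl fun a _ => ?_
  rw [Coframe.nablaTensor, Θ.symm x _ (e.frame c x), e.tensor_frame_apply, e.tensor_frame_apply]
  simp only [h.form_nabla_frame]
  rfl

/-- The defect of the Hamiltonian constraint is twice the `u`-component of the defect of the
momentum constraint. -/
theorem scalarCurvature_sub (x : M) :
    e.scalarCurvature x - (e.normSq Θ x - e.trace Θ x ^ 2) =
      2 * (dirDeriv (e.frame 0) (e.trace Θ) x - e.div Θ (e.frame 0) x) := by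
  rw [dirDeriv_trace]
  simp only [Coframe.scalarCurvature, Coframe.ricci, e.metric_frame_right, h.form_riemann_frame,
    h.div_frame, Coframe.normSq, Coframe.trace]
  simp only [← Coframe.comp.eq_def, Fin.sum_univ_three]
  simp [e.comp_comm Θ 1 0, e.comp_comm Θ 2 0, e.comp_comm Θ 2 1]
  ring

/-- `Θ(e_u)` is closed. -/
theorem dirDeriv_comp_zero (a b : Fin 3) (x : M) :
    dirDeriv (e.frame a) (e.comp Θ 0 b) x - dirDeriv (e.frame b) (e.comp Θ 0 a) x =
      ∑ c, (e.comp Θ c b x * (if 0 = a then 1 else 0) - e.comp Θ c a x * (if 0 = b then 1 else 0))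
        * e.comp Θ 0 c x := by
  -- With a potential $f$, $\Theta_{0c} = E_c(f)$, and closedness is the commutator formula for
  -- $[E_a, E_b](f)$.
  obtain ⟨f, hf, hdf⟩ := h.exact_apply
  have hc : ∀ c, dirDeriv (e.frame c) f = e.comp Θ 0 c := fun c => by
    ext y
    rw [dirDeriv, hdf, e.apply_form]
    rfl
  rw [← hc b, ← hc a, ← e.dirDeriv_lieBracket (e.smooth_frame a) (e.smooth_frame b) hf,
    e.dirDeriv_eq_sum]
  simp only [hc, h.form_lieBracket_frame]

/-- The Jacobi identity for the dual frame. -/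
theorem dirDeriv_comp_one_two (c : Fin 3) (x : M) :
    dirDeriv (e.frame 1) (e.comp Θ c 2) x - dirDeriv (e.frame 2) (e.comp Θ c 1) x =
      e.comp Θ 0 2 x * e.comp Θ c 1 x - e.comp Θ 0 1 x * e.comp Θ c 2 x := by
  have hE := e.smooth_frame
  -- This is $\mathrm{d}(\Theta(e_c)\wedge e_u) = 0$ evaluated on $E_0, E_1, E_2$; note that $[E_1,
  -- E_2] = 0$.
  have hJ := congrArg (e.form c x) (leibniz_identity_lieBracket (hE 0) (hE 1) (hE 2) x)
  rw [map_add, h.form_lieBracket (hE 0) ((hE 1).lieBracket (hE 2)),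
    h.form_lieBracket ((hE 0).lieBracket (hE 1)) (hE 2),
    h.form_lieBracket (hE 1) ((hE 0).lieBracket (hE 2))] at hJ
  simp only [h.form_lieBracket_frame, e.form_frame, e.tensor_frame_apply Θ, dirDeriv_const,
    dirDeriv_comp_mul_sub] at hJ
  simp at hJ
  linarith

/-- Tensoriality in $Z$: the derivatives of the coefficients of $Z$ cancel against those inside
$\nabla Z$. -/
theorem div_eq_sum {Z : VField M} (hZ : SmoothField Z) (x : M) :
    e.div Θ Z x = ∑ c, e.form c x (Z x) * e.div Θ (e.frame c) x := by
  have hE := e.smooth_frame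
  have hZc := e.smoothFunction_form hZ
  have hD : ∀ a, dirDeriv (e.frame a) (fun y => Θ.tensor y (e.frame a y) (Z y)) x =
      ∑ c, (e.form c x (Z x) * dirDeriv (e.frame a) (e.comp Θ a c) x
        + e.comp Θ a c x * dirDeriv (e.frame a) (fun y => e.form c y (Z y)) x) := by
    intro a
    simp only [e.tensor_frame_apply]
    rw [dirDeriv_sum (f := fun c y => e.form c y (Z y) * e.comp Θ a c y)
      fun c => (hZc c).mul (e.smoothFunction_comp Θ a c)]
    exact Finset.sum_congr rfl fun c _ => dirDeriv_mul (hZc c) (e.smoothFunction_comp Θ a c) x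
  simp only [h.div_frame]
  simp only [Coframe.div, Coframe.nablaTensor, hD]
  simp only [Θ.symm x _ (Z x), e.tensor_apply Θ x (Z x), e.tensor_frame_apply Θ,
    h.form_nabla_frame, h.form_nabla (hE _) hZ, Fin.sum_univ_three, e.form_frame]
  simp [e.comp_comm Θ 1 0, e.comp_comm Θ 2 0, e.comp_comm Θ 2 1]
  ring

/-- For $c = 1$ the derivative terms are $(E_1\Theta_{00} - E_0\Theta_{01}) + (E_1\Theta_{22} -
E_2\Theta_{12})$: closedness of $\Theta(e_u)$ gives the first bracket, Jacobi the second. The case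
$c = 2$ is the same with $1$ and $2$ exchanged, whence the sign of `hJ1`. -/
theorem momentum_frame {c : Fin 3} (hc : c ≠ 0) (x : M) :
    dirDeriv (e.frame c) (e.trace Θ) x = e.div Θ (e.frame c) x := by
  rw [h.div_frame, dirDeriv_trace]
  have hJ1 := h.dirDeriv_comp_one_two 1 x
  have hJ2 := h.dirDeriv_comp_one_two 2 x
  have hC1 := h.dirDeriv_comp_zero 1 0 x
  have hC2 := h.dirDeriv_comp_zero 2 0 x
  simp only [Fin.sum_univ_three] at hC1 hC2 ⊢
  simp [e.comp_comm Θ 1 0, e.comp_comm Θ 2 0, e.comp_comm Θ 2 1] at hJ1 hJ2 hC1 hC2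
  fin_cases c
  · exact absurd rfl hc
  · simp [e.comp_comm Θ 1 0, e.comp_comm Θ 2 0, e.comp_comm Θ 2 1]
    linear_combination hC1 + hJ2
  · simp [e.comp_comm Θ 1 0, e.comp_comm Θ 2 0, e.comp_comm Θ 2 1]
    linear_combination hC2 - hJ1

theorem hamiltonianConstraint_iff : HamiltonianConstraint e Θ ↔ MomentumConstraint e Θ := by
  constructor
  · intro hH Z hZ x
    have h0 := h.scalarCurvature_sub x
    rw [hH x] at h0
    rw [h.div_eq_sum hZ, e.dirDeriv_eq_sum]
    refine Finset.sum_congr rfl fun c _ => ?_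
    by_cases hc : c = 0
    · subst hc
      rw [show dirDeriv (e.frame 0) (e.trace Θ) x = e.div Θ (e.frame 0) x by linarith]
    · rw [h.momentum_frame hc]
  · intro hM x
    have h0 := h.scalarCurvature_sub x
    rw [hM _ (e.smooth_frame 0) x] at h0
    linarith

end IsParallelCauchyPair

end Constraints

end ParallelCauchy

end

theorem mainTheorem8 {M : Type*} [TopologicalSpace M]
    [ChartedSpace (EuclideanSpace ℝ (Fin 3)) M] [IsManifold (𝓡 3) ∞ M]
    (e : ParallelCauchy.Coframe M) (Θ : ParallelCauchy.ShapeOperator M)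
    (h : ParallelCauchy.IsParallelCauchyPair e Θ) :
    ParallelCauchy.HamiltonianConstraint e Θ ↔ ParallelCauchy.MomentumConstraint e Θ :=
  h.hamiltonianConstraint_iff
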